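/- Let $T$ be a complete first-order theory in a one-sorted language $L$. A monster model of $T$ is a model $\mathbb{M}$ that is $\kappa$-saturated and strongly $\kappa$-homogeneous for some uncountable cardinal $\kappa > |L|$. "Definable" means definable with parameters; a definable set in a model $M$ is a subset of some $M^n$ (interpretable sets are not included). A topology on $\mathbb{M}$ is definable if there is a definable family $\{B_a\}_{a \in D}$ of subsets of $\mathbb{M}$ which is a basis of open sets for it. The theory $T$ is t-minimal if some monster model $\mathbb{M}$ of $T$ carries a Hausdorff definable topology such that a definable set $X \subseteq \mathbb{M}$ has non-empty interior if and only if $X$ is infinite. Suppose that $T$ is t-minimal, let $M$ be a model of $T$, and let $(K,+,\cdot)$ be a definable field in $M$, that is, a field whose underlying set $K \subseteq M^n$ and whose graphs of addition and multiplication are definable in $M$. Then $K$ is perfect. -/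

import Mathlib

open FirstOrder FirstOrder.Language Cardinal

universe u v w w'

namespace TMin

section Monster

variable (L : FirstOrder.Language.{u, v}) (N : Type w) [L.Structure N]

/-- `N` is `κ`-saturated: every partial type in finitely many variables over a set of fewer than
`κ` parameters which is finitely satisfiable in `N` is realized in `N`. -/
def IsSaturated (κ : Cardinal.{w}) : Prop :=
  ∀ (A : Set N), #A < κ → ∀ (n : ℕ) (p : Set (L[[A]].Formula (Fin n))),
    (∀ p₀ ⊆ p, p₀.Finite → ∃ b : Fin n → N, ∀ φ ∈ p₀, φ.Realize b) →
      ∃ b : Fin n → N, ∀ φ ∈ p, φ.Realize b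

/-- `N` is strongly `κ`-homogeneous: every partial elementary map of `N` whose domain has fewer
than `κ` elements extends to an automorphism of `N`. -/
def IsStronglyHomogeneous (κ : Cardinal.{w}) : Prop :=
  ∀ (A : Set N), #A < κ → ∀ f : A → N,
    (∀ φ : L.Formula A, φ.Realize (fun a : A => (a : N)) ↔ φ.Realize f) →
      ∃ σ : N ≃[L] N, ∀ a : A, σ a = f a

/-- `N` is a monster model (of its complete theory): it is `κ`-saturated and strongly
`κ`-homogeneous for some uncountable cardinal `κ` larger than the cardinality of the language. -/
def IsMonster : Prop :=
  ∃ κ : Cardinal.{w}, ℵ₀ < κ ∧ Cardinal.lift.{w} L.card < Cardinal.lift.{max u v} κ ∧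
    IsSaturated L N κ ∧ IsStronglyHomogeneous L N κ

/-- A topology on `N` is definable if it has a basis of open sets of the form `{B_a : a ∈ D}` for
some definable family `(B_a)_{a ∈ D}`. Here `D ⊆ N ^ m` is definable, and the family is given by a
definable set `B ⊆ N ^ m × N` with `B_a = {x | (a, x) ∈ B}`. Parameters are allowed. -/
def IsDefinableTopology (τ : TopologicalSpace N) : Prop :=
  ∃ (m : ℕ) (D : Set (Fin m → N)) (B : Set (Fin m ⊕ Unit → N)),
    (Set.univ : Set N).Definable L D ∧ (Set.univ : Set N).Definable L B ∧
      @TopologicalSpace.IsTopologicalBasis N τ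
        {U | ∃ a ∈ D, U = {x : N | Sum.elim a (fun _ => x) ∈ B}}

/-- A Hausdorff definable topology on `N` for which a definable subset of `N` (with parameters) has
non-empty interior if and only if it is infinite. -/
structure IsTMinimalTopology (τ : TopologicalSpace N) : Prop where
  t2 : @T2Space N τ
  definable : IsDefinableTopology L N τ
  interior_nonempty_iff : ∀ X : Set N, (Set.univ : Set N).Definable₁ L X →
    ((@interior N τ X).Nonempty ↔ X.Infinite)

end Monster

/-- The theory `T` (meant to be complete) is t-minimal: it has a monster model which carries a
t-minimal definable topology. -/
def IsTMinimal {L : FirstOrder.Language.{u, v}} (T : L.Theory) : Prop :=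
  ∃ (N : Type w) (_ : L.Structure N), Nonempty N ∧ N ⊨ T ∧ IsMonster L N ∧
    ∃ τ : TopologicalSpace N, IsTMinimalTopology L N τ

/-- A field whose underlying set `K` is a subset of `M ^ n` is a definable field in the structure
`M` if `K` and the graphs of addition and multiplication are definable (with parameters). -/
structure IsDefinableField (L : FirstOrder.Language.{u, v}) {M : Type w'} [L.Structure M] {n : ℕ}
    (K : Set (Fin n → M)) [Field K] : Prop where
  carrier : (Set.univ : Set M).Definable L K
  add : (Set.univ : Set M).Definable L
    {t : Fin n ⊕ Fin n ⊕ Fin n → M | ∃ x y : K,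
      t = Sum.elim (x : Fin n → M) (Sum.elim (y : Fin n → M) ((x + y : K) : Fin n → M))}
  mul : (Set.univ : Set M).Definable L
    {t : Fin n ⊕ Fin n ⊕ Fin n → M | ∃ x y : K,
      t = Sum.elim (x : Fin n → M) (Sum.elim (y : Fin n → M) ((x * y : K) : Fin n → M))}

end TMin

namespace TMin

/-! If `K` is imperfect of exponential characteristic `p` and `t` is not a `p`-th power, then `(x,
y) ↦ x ^ p + t * y ^ p` is a definable injection of `K × K` into `K`. That such an injection exists,
for suitable parameters, is one first-order sentence, so completeness of `T` carries it to the
monster model `N`. It remains to refute it there by a dimension count.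

Cut `K` down to an infinite definable `X` on which some coordinate is finite-to-one. The image of
`X` under this coordinate is infinite, so it has interior. Iterating the injection yields a
definable finite-to-finite correspondence between an open box's worth of points of `N ^ (n + 1)` and
points of `N ^ n`. `noDimensionDrop` forbids this.

Two tools replace a dimension theory. Saturation bounds the fibres of a definable family of finite
sets uniformly. With it, a definable subset of `N ^ m` has empty interior exactly when it is thin,
i.e. covered by definable sets `C j` that are finite along lines in direction `j`
(`isThin_of_interior_eq_empty`, `IsThin.interior_eq_empty`). Hence finite unions preserve empty
interior.

`NoDimensionDrop.succ` is the induction step. Discarding sets without interior leaves points `u`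
such that every related `b` is interior to the image of each coordinate slice through `u`. For fixed
`b`, only finitely many slices have `b` interior to their image, and the set of these slices can
only grow near `b`. Where their number is maximal it is locally constant, so a whole open set of `b`
is related to finitely many `u`, which is absurd. -/

/-- `Γ` is identified with a finite power of `N`. -/
class Coords (N : Type w) (Γ : Type w) where
  /-- the index set of the coordinates -/
  idx : Type
  /-- there are finitely many coordinates -/
  finite_idx : Finite idx
  /-- the coordinates of a point -/
  equiv : Γ ≃ (idx → N)

namespace Coords

variable (N : Type w)

instance (Γ : Type w) [Coords N Γ] : Finite (idx N Γ) := finite_idx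

instance self : Coords N N := ⟨Unit, inferInstance, (Equiv.funUnique Unit N).symm⟩

instance pi {β : Type} [Finite β] : Coords N (β → N) := ⟨β, inferInstance, Equiv.refl _⟩

instance prod {Γ Δ : Type w} [Coords N Γ] [Coords N Δ] : Coords N (Γ × Δ) :=
  ⟨idx N Γ ⊕ idx N Δ, inferInstance,
    (Equiv.prodCongr equiv equiv).trans (Equiv.sumArrowEquivProdArrow _ _ _).symm⟩

end Coords

/-! ### Calculus of definable predicates and maps. -/

section Definability

variable {L : FirstOrder.Language.{u, v}} {N : Type w} [L.Structure N] {A : Set N}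
variable {Γ Δ Θ : Type w} [Coords N Γ] [Coords N Δ] [Coords N Θ]

variable (L A) in
/-- The predicate `P` on a finite power of `N` is definable over `A`. -/
def DefPred (P : Γ → Prop) : Prop :=
  A.Definable L {v : Coords.idx N Γ → N | P (Coords.equiv.symm v)}

variable (L A) in
/-- The map `f` between finite powers of `N` is definable over `A`. -/
@[fun_prop]
def DefMap (f : Γ → Δ) : Prop :=
  A.DefinableMap L fun v : Coords.idx N Γ → N => Coords.equiv (f (Coords.equiv.symm v))

namespace DefMap

@[fun_prop]
theorem id : DefMap L A (fun g : Γ => g) := fun i => by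
  simpa using Set.DefinableFun.proj (L := L) (A := A)

@[fun_prop]
theorem comp {f : Δ → Θ} {g : Γ → Δ} (hf : DefMap L A f) (hg : DefMap L A g) :
    DefMap L A (fun x => f (g x)) := fun i => by
  simpa using Set.DefinableFun.comp hg (hf i)

@[fun_prop]
theorem fst : DefMap L A (fun g : Γ × Δ => g.1) := fun i => by
  convert Set.DefinableFun.proj (L := L) (A := A) (i := Sum.inl i) with v
  exact congrFun (Equiv.apply_symm_apply Coords.equiv fun j => v (Sum.inl j)) i

@[fun_prop]
theorem snd : DefMap L A (fun g : Γ × Δ => g.2) := fun i => by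
  convert Set.DefinableFun.proj (L := L) (A := A) (i := Sum.inr i) with v
  exact congrFun (Equiv.apply_symm_apply Coords.equiv fun j => v (Sum.inr j)) i

@[fun_prop]
theorem prodMk {f : Γ → Δ} {g : Γ → Θ} (hf : DefMap L A f) (hg : DefMap L A g) :
    DefMap L A (fun x => (f x, g x)) := by
  rintro (i | i)
  · exact hf i
  · exact hg i

@[fun_prop]
theorem apply {β : Type} [Finite β] (i : β) : DefMap L A (fun v : β → N => v i) := fun _ =>
  Set.DefinableFun.proj (L := L) (A := A) (i := i)

@[fun_prop]
theorem pi {β : Type} [Finite β] {f : Γ → β → N} (hf : ∀ i, DefMap L A fun g => f g i) :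
    DefMap L A f := fun i => hf i ()

@[fun_prop]
theorem const (d : Δ) : DefMap L (Set.univ : Set N) (fun _ : Γ => d) := fun _ =>
  L.definableFun_const _ (Set.mem_univ _)

@[fun_prop]
theorem tail {m : ℕ} : DefMap L A (fun v : Fin (m + 1) → N => Fin.tail v) :=
  pi fun i => apply i.succ

@[fun_prop]
theorem cons {m : ℕ} {f : Γ → N} {g : Γ → Fin m → N} (hf : DefMap L A f) (hg : DefMap L A g) :
    DefMap L A (fun x => (Fin.cons (f x) (g x) : Fin (m + 1) → N)) :=
  pi (Fin.cases (by simpa using hf) fun i => by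
    simpa using comp (f := fun v : Fin m → N => v i) (by fun_prop) hg)

@[fun_prop]
theorem update {m : ℕ} (j : Fin m) {f : Γ → Fin m → N} {t : Γ → N}
    (hf : DefMap L A f) (ht : DefMap L A t) :
    DefMap L A fun g => Function.update (f g) j (t g) := by
  refine DefMap.pi fun i => ?_
  obtain rfl | hij := eq_or_ne i j
  · simpa using ht
  · simpa [hij] using comp (f := fun v : Fin m → N => v i) (by fun_prop) hf

theorem removeNth {m : ℕ} (j : Fin (m + 1)) :
    DefMap L (Set.univ : Set N) fun b : Fin (m + 1) → N => j.removeNth b :=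
  pi fun i => apply (j.succAbove i)

theorem insertNth {m : ℕ} (j : Fin (m + 1)) (a : N) :
    DefMap L (Set.univ : Set N) fun b : Fin m → N => (j.insertNth a b : Fin (m + 1) → N) := by
  refine pi fun i => ?_
  obtain rfl | ⟨i, rfl⟩ := Fin.eq_self_or_eq_succAbove j i
  · simpa using const (Γ := Fin m → N) a
  · simpa using apply (L := L) (A := (Set.univ : Set N)) i

end DefMap

namespace DefPred

theorem comp {P : Δ → Prop} (hP : DefPred L A P) {f : Γ → Δ} (hf : DefMap L A f) :
    DefPred L A fun g => P (f g) := by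
  simpa [DefPred] using! Set.Definable.preimage_map hf hP

theorem congr {P Q : Γ → Prop} (hP : DefPred L A P) (h : ∀ g, Q g ↔ P g) : DefPred L A Q := by
  rwa [show Q = P from funext fun g => propext (h g)]

theorem const (p : Prop) : DefPred L A fun _ : Γ => p := by
  by_cases hp : p
  · exact congr (P := fun _ => True) (Set.definable_univ (L := L) (A := A)) fun _ => by simpa
  · exact congr (P := fun _ => False) (Set.definable_empty (L := L) (A := A)) fun _ => by simpa

theorem not {P : Γ → Prop} (hP : DefPred L A P) : DefPred L A fun g => ¬ P g :=
  Set.Definable.compl hP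

theorem and {P Q : Γ → Prop} (hP : DefPred L A P) (hQ : DefPred L A Q) :
    DefPred L A fun g => P g ∧ Q g :=
  Set.Definable.inter hP hQ

theorem or {P Q : Γ → Prop} (hP : DefPred L A P) (hQ : DefPred L A Q) :
    DefPred L A fun g => P g ∨ Q g :=
  Set.Definable.union hP hQ

theorem imp {P Q : Γ → Prop} (hP : DefPred L A P) (hQ : DefPred L A Q) :
    DefPred L A fun g => P g → Q g :=
  (hP.not.or hQ).congr fun _ => imp_iff_not_or

theorem ex {P : Γ → Δ → Prop} (hP : DefPred L A fun q : Γ × Δ => P q.1 q.2) :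
    DefPred L A fun g => ∃ d, P g d := by
  refine Eq.mp ?_ (Set.Definable.exists_of_finite (L := L) (A := A) hP)
  congr 1
  ext v
  simp only [Set.mem_ofPred_eq]
  refine (Coords.equiv (N := N) (Γ := Δ)).symm.exists_congr fun u => ?_
  rfl

theorem all {P : Γ → Δ → Prop} (hP : DefPred L A fun q : Γ × Δ => P q.1 q.2) :
    DefPred L A fun g => ∀ d, P g d :=
  (ex (P := fun g d => ¬ P g d) hP.not).not.congr fun _ => by simp

theorem allFinite {β : Type*} [Finite β] {P : Γ → β → Prop}
    (hP : ∀ i, DefPred L A fun g => P g i) : DefPred L A fun g => ∀ i, P g i := by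
  have := Set.definable_iInter_of_finite hP
  rwa [← Set.ofPred_forall] at this

theorem exFinite {β : Type*} [Finite β] {P : Γ → β → Prop}
    (hP : ∀ i, DefPred L A fun g => P g i) : DefPred L A fun g => ∃ i, P g i :=
  (allFinite fun i => (hP i).not).not.congr fun _ => by simp

theorem eq {f h : Γ → Δ} (hf : DefMap L A f) (hh : DefMap L A h) :
    DefPred L A fun g => f g = h g := by
  have := Set.definable_iInter_of_finite fun i => (hf i).ofPred_eq (hh i)
  rw [← Set.ofPred_forall] at this
  simpa only [DefPred, ← Equiv.apply_eq_iff_eq (Coords.equiv (N := N) (Γ := Δ)), funext_iff]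

end DefPred

variable (L A) in
/-- The subset `S` of a finite power of `N` is definable over `A`. -/
def DefSet (S : Set Γ) : Prop := DefPred L A fun g => g ∈ S

theorem DefSet.mem {S : Set Δ} (hS : DefSet L A S) {f : Γ → Δ} (hf : DefMap L A f) :
    DefPred L A fun g => f g ∈ S := hS.comp hf

theorem defSet_iff_definable {β : Type} [Finite β] {S : Set (β → N)} :
    DefSet L A S ↔ A.Definable L S := Iff.rfl

theorem defSet_iff_definable₁ {S : Set N} : DefSet L A S ↔ A.Definable₁ L S := by
  constructor
  · intro h
    exact h.mem (DefMap.apply (β := Fin 1) 0)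
  · intro h
    exact DefPred.comp (P := fun x : Fin 1 → N => x 0 ∈ S) h (f := fun x _ => x) (by fun_prop)

end Definability

/-! ### Uniform finiteness from saturation. -/

section UniformFiniteness

variable (L : FirstOrder.Language.{u, v}) (N : Type w) [L.Structure N]

/-- In every definable family of finite sets, the sets have bounded cardinality. -/
def HasUniformFiniteness : Prop :=
  ∀ {Γ Δ : Type w} [Coords N Γ] [Coords N Δ] (S : Set (Γ × Δ)), DefSet L (Set.univ : Set N) S →
    (∀ g, {d | (g, d) ∈ S}.Finite) → ∃ e : ℕ, ∀ g, {d | (g, d) ∈ S}.ncard ≤ e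

variable {L N}

theorem DefMap.equiv_symm {A : Set N} {Δ : Type w} [Coords N Δ] :
    DefMap L A (fun v : Coords.idx N Δ → N => (Coords.equiv.symm v : Δ)) := fun i => by
  simpa only [Equiv.apply_symm_apply] using! Set.DefinableFun.proj (L := L) (A := A) (i := i)

theorem le_ncard_iff_exists_injective {X : Type*} {T : Set X} (hT : T.Finite) {k : ℕ} :
    k ≤ T.ncard ↔ ∃ y : Fin k → X, (∀ i j, i ≠ j → y i ≠ y j) ∧ ∀ i, y i ∈ T := by
  constructor
  · intro h
    have := hT.fintype
    obtain ⟨f⟩ := Function.Embedding.nonempty_of_card_le (α := Fin k) (β := T)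
      (by rwa [Fintype.card_fin, ← Nat.card_eq_fintype_card, Nat.card_coe_set_eq])
    exact ⟨fun i => f i, fun i j hij h => hij (f.injective (Subtype.ext h)), fun i => (f i).2⟩
  · rintro ⟨y, hy, hyT⟩
    have hy' : Function.Injective y := fun i j h => by_contra fun hij => hy i j hij h
    have := Set.ncard_le_ncard (Set.range_subset_iff.2 hyT) hT
    rwa [← Set.image_univ, Set.ncard_image_of_injective _ hy', Set.ncard_univ, Nat.card_fin] at this

theorem DefSet.le_ncard {A : Set N} {Γ Δ : Type w} [Coords N Γ] [Coords N Δ] {S : Set (Γ × Δ)}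
    (hS : DefSet L A S) (hfin : ∀ g, {d | (g, d) ∈ S}.Finite) (k : ℕ) :
    DefPred L A fun g : Γ => k ≤ {d | (g, d) ∈ S}.ncard := by
  have hmap (i : Fin k) : DefMap L A
      (fun y : Fin k × Coords.idx N Δ → N => (Coords.equiv.symm fun j => y (i, j) : Δ)) :=
    DefMap.equiv_symm.comp (DefMap.pi fun j => DefMap.apply (i, j))
  refine (DefPred.ex (P := fun (g : Γ) (y : Fin k × Coords.idx N Δ → N) =>
    (∀ i i', i ≠ i' → (Coords.equiv.symm fun j => y (i, j) : Δ) ≠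
      Coords.equiv.symm fun j => y (i', j)) ∧
    ∀ i, (g, (Coords.equiv.symm fun j => y (i, j) : Δ)) ∈ S) ?_).congr fun g => ?_
  · refine DefPred.and (DefPred.allFinite fun i => DefPred.allFinite fun i' => ?_)
      (DefPred.allFinite fun i => hS.mem (.prodMk .fst ((hmap i).comp .snd)))
    exact (DefPred.const _).imp (DefPred.eq ((hmap i).comp .snd) ((hmap i').comp .snd)).not
  · rw [le_ncard_iff_exists_injective (hfin g)]
    constructor
    · rintro ⟨y, hy, hyS⟩
      exact ⟨fun p => Coords.equiv (y p.1) p.2, by simpa using! hy, by simpa using! hyS⟩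
    · rintro ⟨y, hy, hyS⟩
      exact ⟨fun i => Coords.equiv.symm fun j => y (i, j), hy, hyS⟩

/-- Compactness: if the fibres were unbounded, the conditions "at least `k` points in the fibre"
would form a finitely satisfiable type over finitely many parameters, and a realization would have
an infinite fibre. -/
theorem IsSaturated.hasUniformFiniteness {κ : Cardinal.{w}} (hκ : ℵ₀ ≤ κ)
    (h : IsSaturated L N κ) : HasUniformFiniteness L N := by
  intro Γ Δ _ _ S hS hfin
  obtain ⟨A, -, hA⟩ := Set.definable_iff_finitely_definable.1 hS
  replace hA : DefSet L (A : Set N) S := hA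
  by_contra! hlarge
  obtain ⟨m, ⟨ε⟩⟩ := Finite.exists_equiv_fin (Coords.idx N Γ)
  let ψ : (Fin m → N) → Γ := fun b => Coords.equiv.symm (b ∘ ε)
  have hψ : DefMap L (A : Set N) ψ := DefMap.equiv_symm.comp (DefMap.pi fun j => DefMap.apply (ε j))
  have hψs (g : Γ) : ψ (Coords.equiv g ∘ ε.symm) = g := by
    simp [ψ, Function.comp_def]
  have hform (k : ℕ) : ∃ φ : L[[(A : Set N)]].Formula (Fin m),
      ∀ b, φ.Realize b ↔ k ≤ {d | (ψ b, d) ∈ S}.ncard := by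
    obtain ⟨φ, hφ⟩ := (hA.le_ncard hfin k).comp hψ
    exact ⟨φ, fun b => (Set.ext_iff.1 hφ b).symm⟩
  choose φ hφ using hform
  obtain ⟨b, hb⟩ := h A ((Cardinal.lt_aleph0_of_finite _).trans_le hκ) m (Set.range φ) (by
    intro p₀ hp₀ hfin₀
    obtain ⟨I, hI, rfl⟩ := Set.exists_finite_iff_finset.1
      (show ∃ I : Set ℕ, I.Finite ∧ φ '' I = p₀ from
        (Set.exists_subset_image_finite_and (s := Set.univ) (f := φ) (p := fun t => t = p₀)).1
          ⟨p₀, by simpa using hp₀, hfin₀, rfl⟩ |>.elim fun I hI => ⟨I, hI.2.1, hI.2.2⟩)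
    obtain ⟨g, hg⟩ := hlarge (I.sup id)
    refine ⟨Coords.equiv g ∘ ε.symm, ?_⟩
    rintro _ ⟨k, hk, rfl⟩
    rw [hφ, hψs]
    exact (Finset.le_sup (f := id) hk).trans hg.le)
  -- The fibre over `b` is finite, yet `b` satisfies the bound one above its cardinality.
  have := (hφ _ b).1 (hb _ ⟨{d | (ψ b, d) ∈ S}.ncard + 1, rfl⟩)
  omega

end UniformFiniteness

/-! ### Counting points on finite grids. -/

section Grid

/-- With side `s = m * e + 1`, the grid splits into `s ^ (m - 1)` lines in direction `j`, each with
at most `e` points of `C j`. Together the `C j` contain at most `m * e * s ^ (m - 1) < s ^ m` grid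
points. -/
theorem exists_grid_point_forall_notMem {X : Type*} {m : ℕ} (C : Fin m → Set (Fin m → X)) (e : ℕ)
    (hfin : ∀ j y, {t | Function.update y j t ∈ C j}.Finite)
    (hC : ∀ j y, {t | Function.update y j t ∈ C j}.ncard ≤ e) (S : Fin m → Finset X)
    (hS : ∀ i, (S i).card = m * e + 1) : ∃ y ∈ Fintype.piFinset S, ∀ j, y ∉ C j := by
  classical
  by_contra! hcover
  obtain _ | m := m
  · obtain ⟨j, -⟩ := hcover Fin.elim0 (Fintype.mem_piFinset.2 fun i => i.elim0)
    exact j.elim0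
  have hcard (j : Fin (m + 1)) : ((Fintype.piFinset S).filter (· ∈ C j)).card ≤
      e * ((m + 1) * e + 1) ^ m := by
    have := Finset.card_le_mul_card_image_of_maps_to (f := fun y => j.removeNth y)
      (s := (Fintype.piFinset S).filter (· ∈ C j))
      (t := Fintype.piFinset fun i => S (j.succAbove i))
      (fun y hy => by
        simp only [Finset.mem_filter, Fintype.mem_piFinset] at hy ⊢
        exact fun i => hy.1 _) e (fun z _ => by
        obtain h | ⟨y₀, hy₀⟩ := Finset.eq_empty_or_nonempty
          (((Fintype.piFinset S).filter (· ∈ C j)).filter fun y => j.removeNth y = z)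
        · simp [h]
        have hupd : ∀ y, j.removeNth y = z → Function.update y₀ j (y j) = y := by
          intro y hy
          rw [← (Finset.mem_filter.1 hy₀).2] at hy
          ext i
          obtain rfl | ⟨i, rfl⟩ := Fin.eq_self_or_eq_succAbove j i
          · simp
          · rw [Function.update_of_ne (Fin.succAbove_ne j i)]
            exact (congrFun hy i).symm
        refine le_trans ?_ (hC j y₀)
        rw [Set.ncard_eq_toFinset_card _ (hfin j y₀)]
        refine Finset.card_le_card_of_injOn (fun y => y j) (fun y hy => ?_) fun y hy y' hy' h => ?_
        · simp only [Finset.coe_filter, Finset.mem_filter, Set.mem_ofPred_eq] at hy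
          simp only [Set.Finite.coe_toFinset, Set.mem_ofPred_eq]
          rw [hupd y hy.2]
          exact hy.1.2
        · simp only [Finset.coe_filter, Finset.mem_filter, Set.mem_ofPred_eq] at hy hy'
          rw [← hupd y hy.2, ← hupd y' hy'.2]
          exact congrArg _ h)
    simpa [Fintype.card_piFinset, hS] using this
  have hle : (Fintype.piFinset S).card ≤ ∑ j, ((Fintype.piFinset S).filter (· ∈ C j)).card := by
    refine le_trans (Finset.card_le_card fun y hy => ?_) Finset.card_biUnion_le
    obtain ⟨j, hj⟩ := hcover y hy
    exact Finset.mem_biUnion.2 ⟨j, Finset.mem_univ _, Finset.mem_filter.2 ⟨hy, hj⟩⟩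
  have := hle.trans (Finset.sum_le_sum fun j _ => hcard j)
  simp only [Fintype.card_piFinset, hS, Finset.prod_const, Finset.card_univ, Fintype.card_fin,
    Finset.sum_const, smul_eq_mul, pow_succ] at this
  nlinarith [Nat.pow_pos (n := m) (Nat.succ_pos ((m + 1) * e))]

theorem exists_grid_subset_of_isOpen {X : Type*} [TopologicalSpace X]
    (hX : ∀ U : Set X, IsOpen U → U.Nonempty → U.Infinite) {m : ℕ} {O : Set (Fin m → X)}
    (hO : IsOpen O) (hne : O.Nonempty) (s : ℕ) :
    ∃ S : Fin m → Finset X, (∀ i, (S i).card = s) ∧ ∀ y ∈ Fintype.piFinset S, y ∈ O := by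
  obtain ⟨y, hy⟩ := hne
  obtain ⟨U, hU, hUO⟩ := isOpen_pi_iff'.1 hO y hy
  choose S hSU hS using fun i => (hX (U i) (hU i).1 ⟨_, (hU i).2⟩).exists_subset_card_eq s
  exact ⟨S, hS, fun z hz => hUO fun i _ => hSU i (Fintype.mem_piFinset.1 hz i)⟩

end Grid

/-! ### Thin families. -/

section Thin

variable {L : FirstOrder.Language.{u, v}} {N : Type w} [L.Structure N] {Γ : Type w} [Coords N Γ]

variable (L) in
/-- The family of subsets of `N ^ m` is covered by a definable family of sets `C j`, `j < m`, such
that every line in direction `j` meets `C j` in a finite set. -/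
def IsThin {m : ℕ} (Y : Set (Γ × (Fin m → N))) : Prop :=
  ∃ C : Fin m → Set (Γ × (Fin m → N)), (∀ j, DefSet L (Set.univ : Set N) (C j)) ∧
    (∀ q ∈ Y, ∃ j, q ∈ C j) ∧ ∀ j g y, {t | (g, Function.update y j t) ∈ C j}.Finite

/-- The point is that the grid size `s` does not depend on the member `g` of the family. -/
theorem IsThin.exists_bound (hN : HasUniformFiniteness L N) {m : ℕ} {Y : Set (Γ × (Fin m → N))}
    (hY : IsThin L Y) : ∃ s : ℕ, ∀ g (S : Fin m → Finset N), (∀ i, (S i).card = s) →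
      ∃ y ∈ Fintype.piFinset S, (g, y) ∉ Y := by
  obtain ⟨C, hC, hYC, hfin⟩ := hY
  have hbd (j) : ∃ e : ℕ, ∀ g y, {t | (g, Function.update y j t) ∈ C j}.ncard ≤ e := by
    obtain ⟨e, he⟩ := hN
      {q : (Γ × (Fin m → N)) × N | (q.1.1, Function.update q.1.2 j q.2) ∈ C j}
      ((hC j).mem (.prodMk (by fun_prop) (.update j (by fun_prop) (by fun_prop))))
      fun g => hfin j g.1 g.2
    exact ⟨e, fun g y => he (g, y)⟩
  choose e he using hbd
  refine ⟨m * Finset.univ.sup e + 1, fun g S hS => ?_⟩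
  obtain ⟨y, hy, hyC⟩ := exists_grid_point_forall_notMem (fun j => {y | (g, y) ∈ C j})
    (Finset.univ.sup e) (fun j y => hfin j g y)
    (fun j y => (he j g y).trans (Finset.le_sup (Finset.mem_univ j))) S hS
  exact ⟨y, hy, fun hyY => (hYC _ hyY).elim hyC⟩

end Thin

/-! ### Empty interior equals thinness. -/

section Topology

variable {L : FirstOrder.Language.{u, v}} {N : Type w} [L.Structure N] [τ : TopologicalSpace N]
variable {Γ : Type w} [Coords N Γ]

theorem IsDefinableTopology.exists_basis (h : IsDefinableTopology L N τ) :
    ∃ (r : ℕ) (D : Set (Fin r → N)) (B : Set ((Fin r → N) × N)),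
      DefSet L (Set.univ : Set N) D ∧ DefSet L (Set.univ : Set N) B ∧
      (∀ d ∈ D, IsOpen {x | (d, x) ∈ B}) ∧
      ∀ x (U : Set N), IsOpen U → x ∈ U → ∃ d ∈ D, (d, x) ∈ B ∧ ∀ y, (d, y) ∈ B → y ∈ U := by
  obtain ⟨r, D, B, hD, hB, hbasis⟩ := h
  refine ⟨r, D, {q | Sum.elim q.1 (fun _ => q.2) ∈ B}, hD, ?_, ?_, ?_⟩
  · refine DefSet.mem (S := B) (f := fun q : (Fin r → N) × N => Sum.elim q.1 fun _ => q.2) hB ?_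
    refine DefMap.pi ?_
    rintro (i | i)
    · exact (DefMap.apply i).comp DefMap.fst
    · exact DefMap.snd
  · exact fun d hd => hbasis.isOpen ⟨d, hd, rfl⟩
  · intro x U hU hx
    obtain ⟨_, ⟨d, hd, rfl⟩, hxd, hdU⟩ := hbasis.exists_subset_of_mem_open hx hU
    exact ⟨d, hd, hxd, fun y hy => hdU hy⟩

/-- Interior is first-order: quantify over the indices of basic open sets. -/
theorem DefSet.mem_interior (h : IsDefinableTopology L N τ) {F : Set (Γ × N)}
    (hF : DefSet L (Set.univ : Set N) F) :
    DefPred L (Set.univ : Set N) fun q : Γ × N => q.2 ∈ interior {x | (q.1, x) ∈ F} := by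
  obtain ⟨r, D, B, hD, hB, hBo, hbasis⟩ := h.exists_basis
  refine (DefPred.ex (P := fun (q : Γ × N) (d : Fin r → N) =>
    d ∈ D ∧ (d, q.2) ∈ B ∧ ∀ x, (d, x) ∈ B → (q.1, x) ∈ F) ?_).congr fun q => ?_
  · refine (hD.mem (by fun_prop)).and ((hB.mem (by fun_prop)).and (DefPred.all (Δ := N) ?_))
    exact (hB.mem (by fun_prop)).imp (hF.mem (by fun_prop))
  · rw [_root_.mem_interior]
    constructor
    · rintro ⟨t, ht, hto, hqt⟩
      obtain ⟨d, hd, hqd, hdt⟩ := hbasis _ _ hto hqt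
      exact ⟨d, hd, hqd, fun x hx => ht (hdt x hx)⟩
    · rintro ⟨d, hd, hqd, hdF⟩
      exact ⟨_, hdF, hBo d hd, hqd⟩

theorem DefSet.mem_interior_pi (h : IsDefinableTopology L N τ) {m : ℕ}
    {F : Set (Γ × (Fin m → N))} (hF : DefSet L (Set.univ : Set N) F) :
    DefPred L (Set.univ : Set N) fun q : Γ × (Fin m → N) =>
      q.2 ∈ interior {x | (q.1, x) ∈ F} := by
  obtain ⟨r, D, B, hD, hB, hBo, hbasis⟩ := h.exists_basis
  refine (DefPred.ex (P := fun (q : Γ × (Fin m → N)) (d : Fin m × Fin r → N) =>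
    (∀ i, (fun j => d (i, j)) ∈ D) ∧ (∀ i, ((fun j => d (i, j)), q.2 i) ∈ B) ∧
      ∀ x : Fin m → N, (∀ i, ((fun j => d (i, j)), x i) ∈ B) → (q.1, x) ∈ F) ?_).congr fun q => ?_
  · refine (DefPred.allFinite fun i => hD.mem ?_).and ((DefPred.allFinite fun i => hB.mem ?_).and
      (DefPred.all (Δ := Fin m → N)
        ((DefPred.allFinite fun i => hB.mem ?_).imp (hF.mem (by fun_prop)))))
    · exact .pi fun j => (DefMap.apply (i, j)).comp .snd
    · exact .prodMk (.pi fun j => (DefMap.apply (i, j)).comp .snd)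
        ((DefMap.apply i).comp (.comp .snd .fst))
    · exact .prodMk (.pi fun j => (DefMap.apply (i, j)).comp (.comp .snd .fst))
        ((DefMap.apply i).comp .snd)
  · rw [_root_.mem_interior]
    constructor
    · rintro ⟨t, ht, hto, hqt⟩
      obtain ⟨U, hU, hUt⟩ := isOpen_pi_iff'.1 hto _ hqt
      choose d hd hqd hdU using fun i => hbasis _ _ (hU i).1 (hU i).2
      exact ⟨fun p => d p.1 p.2, hd, hqd, fun x hx => ht (hUt fun i _ => hdU i _ (hx i))⟩
    · rintro ⟨d, hd, hqd, hdF⟩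
      refine ⟨Set.univ.pi fun i => {x | ((fun j => d (i, j)), x) ∈ B},
        fun x hx => hdF x fun i => hx i trivial,
        isOpen_set_pi Set.finite_univ fun i _ => hBo _ (hd i), fun i _ => hqd i⟩

theorem interior_diff_interior {X : Type*} [TopologicalSpace X] (s : Set X) :
    interior (s \ interior s) = ∅ := by
  rw [Set.eq_empty_iff_forall_notMem]
  intro x hx
  exact (interior_subset hx).2 (interior_mono Set.sdiff_subset hx)

theorem IsTMinimalTopology.infinite_of_isOpen (hτ : IsTMinimalTopology L N τ) {U : Set N}
    (hU : IsOpen U) (hne : U.Nonempty) : U.Infinite := by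
  obtain ⟨r, D, B, hD, hB, hBo, hbasis⟩ := hτ.definable.exists_basis
  obtain ⟨x, hx⟩ := hne
  obtain ⟨d, hd, hxd, hdU⟩ := hbasis x U hU hx
  refine Set.Infinite.mono (s := {y | (d, y) ∈ B}) hdU
    ((hτ.interior_nonempty_iff _ (defSet_iff_definable₁.1 ?_)).1 ?_)
  · exact hB.mem (f := fun y : N => (d, y)) (by fun_prop)
  · exact ⟨x, mem_interior.2 ⟨_, subset_rfl, hBo d hd, hxd⟩⟩

/-- The difference is definable and has empty interior, so t-minimality makes it finite. -/
theorem IsTMinimalTopology.finite_diff_interior (hτ : IsTMinimalTopology L N τ) {X : Set N}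
    (hX : DefSet L (Set.univ : Set N) X) : (X \ interior X).Finite := by
  by_contra hinf
  have hd : DefSet L (Set.univ : Set N) (X \ interior X) := by
    refine DefPred.and hX (DefPred.not ?_)
    exact (DefSet.mem_interior hτ.definable (Γ := N) (F := {q : N × N | q.2 ∈ X})
      (hX.mem (by fun_prop))).comp (f := fun x : N => (x, x)) (by fun_prop)
  have := (hτ.interior_nonempty_iff _ (defSet_iff_definable₁.1 hd)).2 hinf
  simp [interior_diff_interior] at this

/-- Non-empty open sets contain grids of every size, thin sets do not. -/
theorem IsThin.interior_eq_empty (hN : HasUniformFiniteness L N) (hτ : IsTMinimalTopology L N τ)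
    {m : ℕ} {Y : Set (Γ × (Fin m → N))} (hY : IsThin L Y) (g : Γ) :
    interior {y | (g, y) ∈ Y} = ∅ := by
  obtain ⟨s, hs⟩ := hY.exists_bound hN
  by_contra hne
  obtain ⟨S, hS, hSY⟩ := exists_grid_subset_of_isOpen
    (fun _ hU hne => hτ.infinite_of_isOpen hU hne) isOpen_interior
    (Set.nonempty_iff_ne_empty.2 hne) s
  obtain ⟨y, hy, hyY⟩ := hs g S hS
  exact hyY (interior_subset (s := {y | (g, y) ∈ Y}) (hSY y hy))

/-- Induction on `m`, splitting off coordinate `0`. Points whose coordinate `0` is not interior to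
its fibre are finite along direction `0`. The others form, for each value of coordinate `0`, a
subset `Z` of `N ^ m`, shown to have empty interior and so thin by induction. Families are needed
because the grid bound must be uniform in the basic open set. -/
theorem isThin_of_interior_eq_empty (hN : HasUniformFiniteness L N)
    (hτ : IsTMinimalTopology L N τ) {m : ℕ} : ∀ {Γ : Type w} [Coords N Γ]
    {Y : Set (Γ × (Fin m → N))}, DefSet L (Set.univ : Set N) Y →
      (∀ g, interior {y | (g, y) ∈ Y} = ∅) → IsThin L Y := by
  induction m with
  | zero =>
    intro Γ _ Y hY hint
    refine ⟨fun j => j.elim0, fun j => j.elim0, fun q hq => ?_, fun j => j.elim0⟩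
    have : {y | (q.1, y) ∈ Y} = Set.univ := Set.eq_univ_of_forall fun y => by
      rwa [Set.mem_ofPred_eq, Subsingleton.elim y q.2]
    simpa [this] using hint q.1
  | succ m ih =>
    intro Γ _ Y hY hint
    obtain ⟨r, D, B, hD, hB, hBo, hbasis⟩ := hτ.definable.exists_basis
    let F : Set ((Γ × (Fin m → N)) × N) := {q | (q.1.1, (Fin.cons q.2 q.1.2 : Fin (m + 1) → N)) ∈ Y}
    have hF : DefSet L (Set.univ : Set N) F := hY.mem (.prodMk (by fun_prop) (by fun_prop))
    let Z : Set ((Γ × N) × (Fin m → N)) :=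
      {q | q.1.2 ∈ interior {x | ((q.1.1, q.2), x) ∈ F}}
    have hZ : DefSet L (Set.univ : Set N) Z :=
      (hF.mem_interior hτ.definable).comp
        (f := fun q : (Γ × N) × (Fin m → N) => ((q.1.1, q.2), q.1.2)) (by fun_prop)
    -- For a fixed non-empty basic open set `B_d`, these are the points over which the fibre
    -- contains all of `B_d`. An interior point would give an open box inside `Y`.
    let Z' : Set ((Γ × (Fin r → N)) × (Fin m → N)) :=
      {q | q.1.2 ∈ D ∧ (∃ x, (q.1.2, x) ∈ B) ∧ ∀ x, (q.1.2, x) ∈ B → ((q.1.1, q.2), x) ∈ F}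
    have hZ' : DefSet L (Set.univ : Set N) Z' := by
      refine (hD.mem (by fun_prop)).and (DefPred.and (DefPred.ex (Δ := N) ?_)
        (DefPred.all (Δ := N) ?_))
      · exact hB.mem (by fun_prop)
      · exact (hB.mem (by fun_prop)).imp (hF.mem (by fun_prop))
    have hZ'int (p : Γ × (Fin r → N)) : interior {x | (p, x) ∈ Z'} = ∅ := by
      rw [Set.eq_empty_iff_forall_notMem]
      intro x hx
      obtain ⟨hdD, ⟨t, ht⟩, -⟩ := interior_subset hx
      have hopen : IsOpen {y : Fin (m + 1) → N | (p.2, y 0) ∈ B ∧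
          Fin.tail y ∈ interior {x | (p, x) ∈ Z'}} := by
        have hc0 : Continuous fun y : Fin (m + 1) → N => y 0 := continuous_apply 0
        have h0 : IsOpen {y : Fin (m + 1) → N | (p.2, y 0) ∈ B} :=
          (hBo p.2 hdD).preimage hc0
        refine h0.inter (isOpen_interior.preimage ?_)
        exact continuous_pi fun i => continuous_apply i.succ
      have : (Fin.cons t x : Fin (m + 1) → N) ∈ interior {y | (p.1, y) ∈ Y} := by
        refine mem_interior.2 ⟨_, fun y hy => ?_, hopen, by simpa using! ⟨ht, hx⟩⟩
        simpa [F] using (interior_subset hy.2 : Fin.tail y ∈ {x | (p, x) ∈ Z'}).2.2 _ hy.1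
      simp [hint] at this
    have hZint (p : Γ × N) : interior {x | (p, x) ∈ Z} = ∅ := by
      obtain ⟨s, hs⟩ := (ih hZ' hZ'int).exists_bound hN
      by_contra hne
      obtain ⟨S, hS, hSZ⟩ := exists_grid_subset_of_isOpen
        (fun _ hU hne => hτ.infinite_of_isOpen hU hne) isOpen_interior
        (Set.nonempty_iff_ne_empty.2 hne) s
      -- A grid is finite, so a single basic neighbourhood of `p.2` serves all its points. This puts
      -- the grid inside one member of `Z'`, against the uniform bound `s`.
      obtain ⟨d, hd, hpd, hdF⟩ := hbasis p.2
        (⋂ y ∈ Fintype.piFinset S, interior {x | ((p.1, y), x) ∈ F})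
        (isOpen_biInter_finset fun _ _ => isOpen_interior)
        (Set.mem_iInter₂.2 fun y hy => (interior_subset (hSZ y hy) : y ∈ {x | (p, x) ∈ Z}))
      obtain ⟨y, hy, hyZ⟩ := hs (p.1, d) S hS
      exact hyZ ⟨hd, ⟨p.2, hpd⟩, fun x hx => 
        interior_subset (s := {x | ((p.1, y), x) ∈ F}) (Set.mem_iInter₂.1 (hdF x hx) y hy)⟩
    obtain ⟨C, hC, hZC, hfin⟩ := ih hZ hZint
    refine ⟨Fin.cases
      {q | q ∈ Y ∧ ¬ q.2 0 ∈ interior {x | ((q.1, Fin.tail q.2), x) ∈ F}}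
      fun j => {q | ((q.1, q.2 0), Fin.tail q.2) ∈ C j}, ?_, ?_, ?_⟩
    · refine Fin.cases ?_ fun j => ?_
      · exact DefPred.and hY (((hF.mem_interior hτ.definable).comp
          (f := fun q : Γ × (Fin (m + 1) → N) => ((q.1, Fin.tail q.2), q.2 0))
          (by fun_prop)).not)
      · exact (hC j).mem (by fun_prop)
    · intro q hq
      by_cases h0 : q.2 0 ∈ interior {x | ((q.1, Fin.tail q.2), x) ∈ F}
      · obtain ⟨j, hj⟩ := hZC ((q.1, q.2 0), Fin.tail q.2) h0
        exact ⟨j.succ, hj⟩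
      · exact ⟨0, hq, h0⟩
    · refine Fin.cases (fun g y => ?_) fun j g y => ?_
      · have := hτ.finite_diff_interior (X := {x | ((g, Fin.tail y), x) ∈ F})
          (hF.mem (by fun_prop))
        refine this.subset fun t ht => ?_
        obtain ⟨hY', hint'⟩ := ht
        simp only [Fin.tail_update_zero, Function.update_self] at hint'
        refine ⟨?_, hint'⟩
        simpa [F, ← Fin.update_cons_zero (y 0) (Fin.tail y) t] using! hY'
      · simpa [Fin.tail_update_succ] using! hfin j (g, y 0) (Fin.tail y)

theorem interior_union_eq_empty (hN : HasUniformFiniteness L N)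
    (hτ : IsTMinimalTopology L N τ) {m : ℕ} {ι : Type*} [Finite ι] {Y : ι → Set (Fin m → N)}
    (hY : ∀ i, DefSet L (Set.univ : Set N) (Y i)) (hint : ∀ i, interior (Y i) = ∅) :
    interior (⋃ i, Y i) = ∅ := by
  have hthin (i : ι) : IsThin L {q : (Fin 0 → N) × (Fin m → N) | q.2 ∈ Y i} :=
    isThin_of_interior_eq_empty hN hτ ((hY i).mem (by fun_prop)) fun _ => hint i
  choose C hC hYC hfin using hthin
  have : IsThin L {q : (Fin 0 → N) × (Fin m → N) | q.2 ∈ ⋃ i, Y i} := by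
    refine ⟨fun j => ⋃ i, C i j, fun j => ?_, fun q hq => ?_, fun j g y => ?_⟩
    · exact (DefPred.exFinite fun i => hC i j).congr fun q => by simp
    · obtain ⟨i, hi⟩ := Set.mem_iUnion.1 hq
      obtain ⟨j, hj⟩ := hYC i q hi
      exact ⟨j, Set.mem_iUnion.2 ⟨i, hj⟩⟩
    · refine (Set.finite_iUnion fun i => hfin i j g y).subset fun t ht => ?_
      simpa using ht
  exact this.interior_eq_empty hN hτ Fin.elim0

end Topology

/-! ### Finite-to-finite correspondences cannot lower dimension. -/

section Correspondence

/-- A correspondence relating every point to only finitely many points, on both sides. -/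
structure IsFiniteToFinite {X Y : Type*} (R : Set (X × Y)) : Prop where
  left : ∀ x, {y | (x, y) ∈ R}.Finite
  right : ∀ y, {x | (x, y) ∈ R}.Finite

theorem infinite_of_isOpen_pi {X : Type*} [TopologicalSpace X]
    (hX : ∀ U : Set X, IsOpen U → U.Nonempty → U.Infinite) {m : ℕ} {O : Set (Fin (m + 1) → X)}
    (hO : IsOpen O) (hne : O.Nonempty) : O.Infinite := by
  intro hfin
  obtain ⟨S, hS, hSO⟩ := exists_grid_subset_of_isOpen hX hO hne (O.ncard + 1)
  have := Set.ncard_le_ncard (s := (Fintype.piFinset S : Set (Fin (m + 1) → X))) hSO hfin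
  rw [Set.ncard_coe_finset, Fintype.card_piFinset] at this
  simp only [hS, Finset.prod_const, Finset.card_univ, Fintype.card_fin] at this
  have := Nat.le_self_pow (n := m + 1) (by omega) (O.ncard + 1)
  omega

variable {L : FirstOrder.Language.{u, v}} {N : Type w} [L.Structure N] [τ : TopologicalSpace N]

variable (L N) in
/-- A definable finite-to-finite correspondence between `N ^ (m + 1)` and `N ^ m` has a domain with
empty interior. -/
def NoDimensionDrop (m : ℕ) : Prop :=
  ∀ R : Set ((Fin (m + 1) → N) × (Fin m → N)), DefSet L (Set.univ : Set N) R →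
    IsFiniteToFinite R → interior {u | ∃ b, (u, b) ∈ R} = ∅

theorem noDimensionDrop_zero (hτ : IsTMinimalTopology L N τ) : NoDimensionDrop L N 0 := by
  intro R _ hfin
  by_contra hne
  refine infinite_of_isOpen_pi (fun _ hU hne => hτ.infinite_of_isOpen hU hne)
    isOpen_interior (Set.nonempty_iff_ne_empty.2 hne)
    ((hfin.right Fin.elim0).subset (interior_subset.trans ?_))
  rintro u ⟨b, hb⟩
  rwa [Set.mem_ofPred_eq, Subsingleton.elim Fin.elim0 b]

/-- A range without interior is thin. On its `j`-th piece, forgetting coordinate `j` is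
finite-to-one, so each piece gives a correspondence with `N ^ m`, to which `hm` applies. -/
theorem NoDimensionDrop.interior_dom_eq_empty (hN : HasUniformFiniteness L N)
    (hτ : IsTMinimalTopology L N τ) {m : ℕ} (hm : NoDimensionDrop L N m)
    {R : Set ((Fin (m + 1) → N) × (Fin (m + 1) → N))} (hR : DefSet L (Set.univ : Set N) R)
    (hfin : IsFiniteToFinite R) (hint : interior {b | ∃ u, (u, b) ∈ R} = ∅) :
    interior {u | ∃ b, (u, b) ∈ R} = ∅ := by
  obtain ⟨C, hC, hRC, hCfin⟩ := isThin_of_interior_eq_empty hN hτ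
    (Y := {q : (Fin 0 → N) × (Fin (m + 1) → N) | ∃ u, (u, q.2) ∈ R})
    (DefPred.ex (Δ := Fin (m + 1) → N) (hR.mem (by fun_prop))) fun _ => hint
  let R' (j : Fin (m + 1)) : Set ((Fin (m + 1) → N) × (Fin m → N)) :=
    {q | ∃ b, (q.1, b) ∈ R ∧ ((Fin.elim0, b) : (Fin 0 → N) × _) ∈ C j ∧ q.2 = j.removeNth b}
  have hR' (j) : DefSet L (Set.univ : Set N) (R' j) := by
    refine DefPred.ex (Δ := Fin (m + 1) → N) ((hR.mem (by fun_prop)).and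
      (((hC j).mem (by fun_prop)).and (DefPred.eq (by fun_prop) ?_)))
    exact (DefMap.removeNth j).comp .snd
  have hfin' (j) : IsFiniteToFinite (R' j) := by
    constructor
    · intro u
      refine ((hfin.left u).image fun b => j.removeNth b).subset ?_
      rintro _ ⟨b, hb, -, rfl⟩
      exact ⟨b, hb, rfl⟩
    · intro z
      have hz : {b | ((Fin.elim0, b) : (Fin 0 → N) × _) ∈ C j ∧ z = j.removeNth b}.Finite := by
        obtain h | ⟨b₀, -, hb₀⟩ := Set.eq_empty_or_nonempty
          {b | ((Fin.elim0, b) : (Fin 0 → N) × _) ∈ C j ∧ z = j.removeNth b}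
        · simp [h]
        refine ((hCfin j Fin.elim0 b₀).image fun t => Function.update b₀ j t).subset ?_
        rintro b ⟨hbC, rfl⟩
        have : Function.update b₀ j (b j) = b := by
          ext i
          obtain rfl | ⟨i, rfl⟩ := Fin.eq_self_or_eq_succAbove j i
          · simp
          · rw [Function.update_of_ne (Fin.succAbove_ne j i)]
            exact (congrFun hb₀ i).symm
        exact ⟨b j, by rwa [Set.mem_ofPred_eq, this], this⟩
      refine (hz.biUnion fun b _ => hfin.right b).subset ?_
      rintro u ⟨b, hb, hbC, hbz⟩
      exact Set.mem_biUnion (x := b) ⟨hbC, hbz⟩ hb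
  rw [Set.eq_empty_iff_forall_notMem]
  intro u hu
  have hsub : {u | ∃ b, (u, b) ∈ R} ⊆ ⋃ j, {u | ∃ z, (u, z) ∈ R' j} := by
    rintro u ⟨b, hb⟩
    obtain ⟨j, hj⟩ := hRC (Fin.elim0, b) ⟨u, hb⟩
    exact Set.mem_iUnion.2 ⟨j, _, b, hb, hj, rfl⟩
  have := interior_mono hsub hu
  rw [interior_union_eq_empty hN hτ (Y := fun j => {u | ∃ z, (u, z) ∈ R' j})
    (fun j => DefPred.ex (Δ := Fin m → N) ((hR' j).mem
    (by fun_prop))) fun j => hm _ (hR' j) (hfin' j)] at this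
  exact this

section Slices

variable {k m : ℕ} (R : Set ((Fin (k + 1) → N) × (Fin m → N)))

/-- The points related by `R` to a point of `G` with `i`-th coordinate `a`. -/
def sliceImage (G : Set (Fin (k + 1) → N)) (i : Fin (k + 1)) (a : N) : Set (Fin m → N) :=
  {b | ∃ u ∈ G, u i = a ∧ (u, b) ∈ R}

/-- The points of `G` related by `R` to a point that is not in the interior of the image of the
slice of `G` in direction `i`. -/
def badPoints (G : Set (Fin (k + 1) → N)) (i : Fin (k + 1)) : Set (Fin (k + 1) → N) :=
  {u | u ∈ G ∧ ∃ b, (u, b) ∈ R ∧ b ∉ interior (sliceImage R G i (u i))}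

/-- The points of `G` all of whose `R`-related points are in the interiors of the images of the
slices of `G`. -/
def goodPoints (G : Set (Fin (k + 1) → N)) : Set (Fin (k + 1) → N) :=
  {u | u ∈ G ∧ ∀ i, u ∉ badPoints R G i}

variable {R}

theorem DefSet.badPoints (hτ : IsTMinimalTopology L N τ) (hR : DefSet L (Set.univ : Set N) R)
    {G : Set (Fin (k + 1) → N)} (hG : DefSet L (Set.univ : Set N) G) (i : Fin (k + 1)) :
    DefSet L (Set.univ : Set N) (badPoints R G i) := by
  have himg : DefSet L (Set.univ : Set N)
      {q : N × (Fin m → N) | ∃ u, u ∈ G ∧ u i = q.1 ∧ (u, q.2) ∈ R} :=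
    DefPred.ex (Δ := Fin (k + 1) → N) ((hG.mem (by fun_prop)).and
      ((DefPred.eq ((DefMap.apply i).comp .snd) (by fun_prop)).and (hR.mem (by fun_prop))))
  refine DefPred.and hG (DefPred.ex (Δ := Fin m → N) ((hR.mem (by fun_prop)).and (DefPred.not ?_)))
  exact (himg.mem_interior_pi hτ.definable).comp
    (f := fun q : (Fin (k + 1) → N) × (Fin m → N) => (q.1 i, q.2))
    (.prodMk ((DefMap.apply i).comp .fst) .snd)

theorem DefSet.goodPoints (hτ : IsTMinimalTopology L N τ) (hR : DefSet L (Set.univ : Set N) R)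
    {G : Set (Fin (k + 1) → N)} (hG : DefSet L (Set.univ : Set N) G) :
    DefSet L (Set.univ : Set N) (goodPoints R G) :=
  DefPred.and hG (DefPred.allFinite fun i => (DefSet.badPoints hτ hR hG i).not)

end Slices

section Step

variable {m : ℕ} {R : Set ((Fin (m + 1 + 1) → N) × (Fin (m + 1) → N))}

/-- Restrict `R` to a slice, keeping only related points outside the interior of the slice's image.
The range then lies in a set minus its interior, so the domain has empty interior in the slice. An
interior bad point would make the domain of its own slice have interior. -/
theorem NoDimensionDrop.interior_badPoints (hN : HasUniformFiniteness L N)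
    (hτ : IsTMinimalTopology L N τ) (hm : NoDimensionDrop L N m)
    (hR : DefSet L (Set.univ : Set N) R) (hfin : IsFiniteToFinite R)
    {G : Set (Fin (m + 1 + 1) → N)} (hG : DefSet L (Set.univ : Set N) G) (i : Fin (m + 1 + 1)) :
    interior (badPoints R G i) = ∅ := by
  rw [Set.eq_empty_iff_forall_notMem]
  intro x hx
  let R' : Set ((Fin (m + 1) → N) × (Fin (m + 1) → N)) :=
    {q | (i.insertNth (x i) q.1, q.2) ∈ R ∧ i.insertNth (x i) q.1 ∈ G ∧
      q.2 ∉ interior (sliceImage R G i (x i))}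
  have hins : DefMap L (Set.univ : Set N) fun q : (Fin (m + 1) → N) × (Fin (m + 1) → N) =>
      (i.insertNth (x i) q.1 : Fin (m + 1 + 1) → N) := (DefMap.insertNth i (x i)).comp .fst
  have himg : DefSet L (Set.univ : Set N)
      {q : (Fin 0 → N) × (Fin (m + 1) → N) | ∃ u, u ∈ G ∧ u i = x i ∧ (u, q.2) ∈ R} :=
    DefPred.ex (Δ := Fin (m + 1 + 1) → N) ((hG.mem (by fun_prop)).and
      ((DefPred.eq ((DefMap.apply i).comp .snd) (by fun_prop)).and (hR.mem (by fun_prop))))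
  have hR' : DefSet L (Set.univ : Set N) R' := by
    refine (hR.mem (.prodMk hins .snd)).and ((hG.mem hins).and (DefPred.not ?_))
    exact (himg.mem_interior_pi hτ.definable).comp 
      (f := fun q : (Fin (m + 1) → N) × (Fin (m + 1) → N) => ((Fin.elim0 : Fin 0 → N), q.2))
      (.prodMk (.const _) .snd)
  have hfin' : IsFiniteToFinite R' :=
    ⟨fun u => (hfin.left (i.insertNth (x i) u)).subset fun b hb => hb.1, fun b =>
      ((hfin.right b).preimage (f := fun u => (i.insertNth (x i) u : Fin (m + 1 + 1) → N))
        (Fin.insertNth_right_injective (α := fun _ => N) (x i)).injOn).subset fun u hu => hu.1⟩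
  have hrng : interior {b | ∃ u, (u, b) ∈ R'} = ∅ := by
    refine Set.subset_empty_iff.1 (Set.Subset.trans (interior_mono ?_)
      (interior_diff_interior (sliceImage R G i (x i))).subset)
    rintro b ⟨u, huR, huG, hb⟩
    exact ⟨⟨_, huG, by simp, huR⟩, hb⟩
  have hdom := hm.interior_dom_eq_empty hN hτ hR' hfin' hrng
  have hcont : Continuous fun u : Fin (m + 1) → N =>
      (i.insertNth (x i) u : Fin (m + 1 + 1) → N) := by
    refine continuous_pi fun j => ?_
    obtain rfl | ⟨j, rfl⟩ := Fin.eq_self_or_eq_succAbove i j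
    · simpa using continuous_const
    · simpa using continuous_apply j
  have : i.removeNth x ∈ interior {u | ∃ b, (u, b) ∈ R'} := by
    refine mem_interior.2 ⟨_, fun u hu => ?_, isOpen_interior.preimage hcont,
      (by simpa using hx : i.insertNth (x i) (i.removeNth x) ∈ interior (badPoints R G i))⟩
    obtain ⟨huG, b, hub, hb⟩ := interior_subset (s := badPoints R G i) hu
    exact ⟨b, hub, huG, by simpa using hb⟩
  rw [hdom] at this
  exact this

theorem NoDimensionDrop.interior_goodPoints (hN : HasUniformFiniteness L N)
    (hτ : IsTMinimalTopology L N τ) (hm : NoDimensionDrop L N m)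
    (hR : DefSet L (Set.univ : Set N) R) (hfin : IsFiniteToFinite R)
    {G : Set (Fin (m + 1 + 1) → N)} (hG : DefSet L (Set.univ : Set N) G)
    (hint : interior G ≠ ∅) : interior (goodPoints R G) ≠ ∅ := by
  intro hgood
  refine hint (Set.subset_empty_iff.1 ?_)
  rw [← interior_union_eq_empty hN hτ
    (Y := fun o : Option (Fin (m + 1 + 1)) => o.elim (goodPoints R G) (badPoints R G))
    (by
      rintro (_ | i)
      · exact DefSet.goodPoints hτ hR hG
      · exact DefSet.badPoints hτ hR hG i)
    (by
      rintro (_ | i)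
      · exact hgood
      · exact hm.interior_badPoints hN hτ hR hfin hG i)]
  refine interior_mono fun u hu => ?_
  by_cases hbad : ∃ i, u ∈ badPoints R G i
  · exact Set.mem_iUnion.2 ⟨some hbad.choose, hbad.choose_spec⟩
  · exact Set.mem_iUnion.2 ⟨none, hu, not_exists.1 hbad⟩

theorem NoDimensionDrop.succ (hN : HasUniformFiniteness L N)
    (hτ : IsTMinimalTopology L N τ) (hm : NoDimensionDrop L N m) : NoDimensionDrop L N (m + 1) := by
  intro R hR hfin
  by_contra hne
  set Z : Set (Fin (m + 1 + 1) → N) := {u | ∃ b, (u, b) ∈ R} with hZdef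
  have hZ : DefSet L (Set.univ : Set N) Z :=
    DefPred.ex (Δ := Fin (m + 1) → N) (hR.mem (by fun_prop))
  -- Good points are taken twice: the second round yields an open set inside the image of a slice of
  -- `goodPoints R Z`, so every point of it is related to a good point of `Z`.
  have hG := DefSet.goodPoints hτ hR hZ
  obtain ⟨u, hu⟩ := (Set.nonempty_iff_ne_empty.2 (hm.interior_goodPoints hN hτ hR hfin hG
    (hm.interior_goodPoints hN hτ hR hfin hZ hne))).mono interior_subset
  obtain ⟨b₀, hb₀⟩ := hu.1.1
  have hb₀O : b₀ ∈ interior (sliceImage R (goodPoints R Z) 0 (u 0)) := by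
    by_contra h
    exact hu.2 0 ⟨hu.1, b₀, hb₀, h⟩
  -- The slices in direction `i` whose image has `b` in its interior. Their values are coordinates
  -- of points related to `b`, hence finite and uniformly bounded in number.
  let A (b : Fin (m + 1) → N) (i : Fin (m + 1 + 1)) : Set N :=
    {a | b ∈ interior (sliceImage R Z i a)}
  have hAsub (b i) : A b i ⊆ (fun u => u i) '' {u | (u, b) ∈ R} := by
    intro a ha
    obtain ⟨u, -, hua, hub⟩ := interior_subset (s := sliceImage R Z i a) ha
    exact ⟨u, hub, hua⟩
  have hAfin (b i) : (A b i).Finite := ((hfin.right b).image _).subset (hAsub b i)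
  obtain ⟨e, he⟩ := hN {q : (Fin (m + 1) → N) × (Fin (m + 1 + 1) → N) | (q.2, q.1) ∈ R}
    (hR.mem (by fun_prop)) hfin.right
  have hbd (b) : ∑ i, (A b i).ncard ≤ (m + 1 + 1) * e := by
    refine (Finset.sum_le_card_nsmul _ _ e fun i _ => ?_).trans (by simp)
    exact (Set.ncard_le_ncard (hAsub b i) ((hfin.right b).image _)).trans
      ((Set.ncard_image_le (hfin.right b)).trans (he b))
  -- Minimizing the bound minus the sum maximizes the sum. The bound `hbd` keeps the truncated
  -- subtraction faithful.
  obtain ⟨b, hbO, hbmax⟩ := (measure fun b => (m + 1 + 1) * e - ∑ i, (A b i).ncard).wf.has_min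
    _ ⟨b₀, hb₀O⟩
  let O : Set (Fin (m + 1) → N) := interior (sliceImage R (goodPoints R Z) 0 (u 0)) ∩
    ⋂ i, ⋂ a ∈ A b i, interior (sliceImage R Z i a)
  have hO : IsOpen O := isOpen_interior.inter (isOpen_iInter_of_finite fun i =>
    (hAfin b i).isOpen_biInter fun a _ => isOpen_interior)
  have hbO' : b ∈ O := ⟨hbO, Set.mem_iInter.2 fun i => Set.mem_iInter₂.2 fun a ha => ha⟩
  refine infinite_of_isOpen_pi (fun _ hU hne => hτ.infinite_of_isOpen hU hne) hO ⟨b, hbO'⟩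
    (((Set.Finite.pi' (hAfin b)).biUnion fun u' _ => hfin.left u').subset ?_)
  rintro b' ⟨hb'O, hb'A⟩
  have hle (i) : A b i ⊆ A b' i := fun a ha => Set.mem_iInter₂.1 (Set.mem_iInter.1 hb'A i) a ha
  have hcard (i) : (A b i).ncard ≤ (A b' i).ncard := Set.ncard_le_ncard (hle i) (hAfin b' i)
  have hsum : ∑ i, (A b i).ncard = ∑ i, (A b' i).ncard := by
    refine (Finset.sum_le_sum fun i _ => hcard i).antisymm ?_
    have h1 : ¬ (m + 1 + 1) * e - ∑ i, (A b' i).ncard < (m + 1 + 1) * e - ∑ i, (A b i).ncard :=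
      hbmax b' hb'O
    have h2 := hbd b'
    omega
  have heq (i) : A b i = A b' i := Set.eq_of_subset_of_ncard_le (hle i)
    ((Finset.sum_eq_sum_iff_of_le fun i _ => hcard i).1 hsum i (Finset.mem_univ i)).ge
    (hAfin b' i)
  -- Goodness of `u'` puts each `u' i` in `A b' i = A b i`, so `u'` ranges over a finite box that is
  -- independent of `b'`.
  obtain ⟨u', hu'G, -, hu'b'⟩ := interior_subset hb'O
  refine Set.mem_biUnion (x := u') (fun i => ?_) hu'b'
  rw [heq]
  by_contra h
  exact hu'G.2 i ⟨hu'G.1, b', hu'b', h⟩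

end Step

theorem noDimensionDrop (hN : HasUniformFiniteness L N) (hτ : IsTMinimalTopology L N τ) (m : ℕ) :
    NoDimensionDrop L N m := by
  induction m with
  | zero => exact noDimensionDrop_zero hτ
  | succ m ih => exact ih.succ hN hτ

end Correspondence

/-- The ternary relation `H` restricts to the graph of an injection of `K × K` into `K`, where `K`
has at least two elements. -/
structure IsPairing {X : Type*} (K : Set X) (H : Set ((X × X) × X)) : Prop where
  nontrivial : ∃ x ∈ K, ∃ y ∈ K, x ≠ y
  total : ∀ x ∈ K, ∀ y ∈ K, ∃ z ∈ K, ((x, y), z) ∈ H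
  injective : ∀ x ∈ K, ∀ y ∈ K, ∀ x' ∈ K, ∀ y' ∈ K, ∀ z ∈ K,
    ((x, y), z) ∈ H → ((x', y'), z) ∈ H → x = x' ∧ y = y'
  functional : ∀ x ∈ K, ∀ y ∈ K, ∀ z ∈ K, ∀ z' ∈ K,
    ((x, y), z) ∈ H → ((x, y), z') ∈ H → z = z'

/-- A finite `K` would satisfy `|K| ^ 2 ≤ |K|` with `|K| ≥ 2`. -/
theorem IsPairing.infinite {X : Type*} {K : Set X} {H : Set ((X × X) × X)} (h : IsPairing K H) :
    K.Infinite := by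
  intro hfin
  have := hfin.to_subtype
  choose f hfK hf using fun p : K × K => h.total p.1 p.1.2 p.2 p.2.2
  have hinj : Function.Injective fun p => (⟨f p, hfK p⟩ : K) := by
    intro p q hpq
    have hpq' : f p = f q := congrArg Subtype.val hpq
    obtain ⟨h1, h2⟩ := h.injective _ p.1.2 _ p.2.2 _ q.1.2 _ q.2.2 _ (hfK p) (hf p)
      (by rw [hpq']; exact hf q)
    exact Prod.ext (Subtype.ext h1) (Subtype.ext h2)
  have hcard := Nat.card_le_card_of_injective _ hinj
  obtain ⟨x, hx, y, hy, hxy⟩ := h.nontrivial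
  have : Nontrivial K := ⟨⟨x, hx⟩, ⟨y, hy⟩, fun h => hxy (congrArg Subtype.val h)⟩
  have h1 := Finite.one_lt_card (α := K)
  rw [Nat.card_prod] at hcard
  nlinarith

/-! ### No definable pairing in a t-minimal topology. -/

section Pairing

variable {L : FirstOrder.Language.{u, v}} {N : Type w} [L.Structure N]

/-- `I` holds the coordinates not yet known to be constant. If a coordinate has an infinite fibre,
pass to that fibre and make it constant; this must stop, since a set with all coordinates constant
is finite. -/
theorem exists_infinite_subset_with_finite_coordinate_fibers {n : ℕ} (I : Finset (Fin n)) :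
    ∀ {X : Set (Fin n → N)}, DefSet L (Set.univ : Set N) X → X.Infinite →
      (∀ i ∉ I, ∀ x ∈ X, ∀ y ∈ X, x i = y i) →
      ∃ X' ⊆ X, DefSet L (Set.univ : Set N) X' ∧ X'.Infinite ∧
        ∃ i, ∀ t, {x | x ∈ X' ∧ x i = t}.Finite := by
  classical
  induction I using Finset.induction_on with
  | empty =>
    intro X _ hinf hconst
    refine absurd (Set.Subsingleton.finite fun x hx y hy => ?_) hinf
    exact funext fun i => hconst i (by simp) x hx y hy
  | insert i I _ ih =>
    intro X hX hinf hconst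
    by_cases hfin : ∀ t, {x | x ∈ X ∧ x i = t}.Finite
    · exact ⟨X, subset_rfl, hX, hinf, i, hfin⟩
    · push Not at hfin
      obtain ⟨t, ht⟩ := hfin
      obtain ⟨X', hX', h⟩ := ih (X := {x | x ∈ X ∧ x i = t})
        (DefPred.and hX (DefPred.eq (DefMap.apply i) (by fun_prop))) ht fun j hj x hx y hy => by
          obtain rfl | hij := eq_or_ne j i
          · rw [hx.2, hy.2]
          · exact hconst j (by simp [hij, hj]) x hx.1 y hy.1
      exact ⟨X', fun x hx => (hX' hx).1, h⟩

/-- Iterated pairing: lift the first entry of `u` to `x ∈ X`, code the tail by `y ∈ K`, and pair `x`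
with `y`. Lifting has finitely many choices, and injectivity recovers `x` and `y` from the code. -/
theorem IsPairing.exists_isFiniteToFinite {n : ℕ} {K X : Set (Fin n → N)}
    {H : Set (((Fin n → N) × (Fin n → N)) × (Fin n → N))} (h : IsPairing K H)
    (hK : DefSet L (Set.univ : Set N) K) (hH : DefSet L (Set.univ : Set N) H) (hXK : X ⊆ K)
    (hX : DefSet L (Set.univ : Set N) X) {i₀ : Fin n} (hi₀ : ∀ t, {x | x ∈ X ∧ x i₀ = t}.Finite)
    (k : ℕ) : ∃ R : Set ((Fin k → N) × (Fin n → N)), DefSet L (Set.univ : Set N) R ∧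
      IsFiniteToFinite R ∧ (∀ q ∈ R, q.2 ∈ K) ∧
        ∀ u : Fin k → N, (∀ i, ∃ x ∈ X, x i₀ = u i) → ∃ b, (u, b) ∈ R := by
  induction k with
  | zero =>
    obtain ⟨c, hc, -⟩ := h.nontrivial
    refine ⟨{q | q.2 = c}, DefPred.eq (by fun_prop) (by fun_prop), ⟨fun x => ?_, fun y => ?_⟩, ?_,
      fun _ _ => ⟨c, rfl⟩⟩
    · simp
    · exact Set.toFinite _
    · rintro ⟨x, y⟩ rfl
      exact hc
  | succ k ih =>
    obtain ⟨R, hR, hfin, hRK, hdom⟩ := ih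
    refine ⟨{q | ∃ x y, x ∈ X ∧ x i₀ = q.1 0 ∧ (Fin.tail q.1, y) ∈ R ∧ q.2 ∈ K ∧
      ((x, y), q.2) ∈ H}, ?_, ⟨fun u => ?_, fun b => ?_⟩, ?_, fun u hu => ?_⟩
    · refine DefPred.ex (Δ := Fin n → N) (DefPred.ex (Δ := Fin n → N) ?_)
      refine (hX.mem (by fun_prop)).and ((DefPred.eq ?_ ?_).and ((hR.mem (by fun_prop)).and
        ((hK.mem (by fun_prop)).and (hH.mem (by fun_prop)))))
      · exact (DefMap.apply i₀).comp (by fun_prop)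
      · exact (DefMap.apply 0).comp (.comp .fst (.comp .fst .fst))
    · refine ((hi₀ (u 0)).biUnion fun x hx => (hfin.left (Fin.tail u)).biUnion
        (t := fun y => {z | z ∈ K ∧ ((x, y), z) ∈ H}) fun y hy => ?_).subset ?_
      · exact Set.Subsingleton.finite fun z hz z' hz' =>
          h.functional _ (hXK hx.1) _ (hRK _ hy) _ hz.1 _ hz'.1 hz.2 hz'.2
      · rintro z ⟨x, y, hx, hxu, hy, hz⟩
        exact Set.mem_biUnion (x := x) ⟨hx, hxu⟩ (Set.mem_biUnion (x := y) hy hz)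
    · obtain h' | ⟨u₀, x₀, y₀, hx₀, -, hy₀, hbK, hH₀⟩ := Set.eq_empty_or_nonempty
        {u : Fin (k + 1) → N | ∃ x y, x ∈ X ∧ x i₀ = u 0 ∧ (Fin.tail u, y) ∈ R ∧ b ∈ K ∧
          ((x, y), b) ∈ H}
      · exact h' ▸ Set.finite_empty
      · refine ((hfin.right y₀).image fun u => (Fin.cons (x₀ i₀) u : Fin (k + 1) → N)).subset ?_
        rintro u ⟨x, y, hx, hxu, hy, -, hH'⟩
        obtain ⟨rfl, rfl⟩ := h.injective _ (hXK hx) _ (hRK _ hy) _ (hXK hx₀) _ (hRK _ hy₀) _ hbK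
          hH' hH₀
        exact ⟨Fin.tail u, hy, by simp [hxu]⟩
    · rintro ⟨u, b⟩ ⟨x, y, -, -, -, hb, -⟩
      exact hb
    · obtain ⟨x, hx, hxu⟩ := hu 0
      obtain ⟨y, hy⟩ := hdom (Fin.tail u) fun i => hu i.succ
      obtain ⟨z, hz, hH'⟩ := h.total x (hXK hx) y (hRK _ hy)
      exact ⟨z, x, y, hx, hxu, hy, hz, hH'⟩

theorem not_isPairing_of_isTMinimalTopology [τ : TopologicalSpace N]
    (hN : HasUniformFiniteness L N) (hτ : IsTMinimalTopology L N τ) {n : ℕ}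
    {K : Set (Fin n → N)} {H : Set (((Fin n → N) × (Fin n → N)) × (Fin n → N))}
    (hK : DefSet L (Set.univ : Set N) K) (hH : DefSet L (Set.univ : Set N) H) :
    ¬ IsPairing K H := by
  intro h
  obtain ⟨X, hXK, hX, hinf, i₀, hi₀⟩ := exists_infinite_subset_with_finite_coordinate_fibers
    Finset.univ hK h.infinite (by simp)
  -- `K` lies in `N ^ n`, so `n + 1` coordinates are one too many.
  obtain ⟨R, hR, hfin, -, hdom⟩ := h.exists_isFiniteToFinite hK hH hXK hX hi₀ (n + 1)
  have hU : ((fun x => x i₀) '' X).Infinite := by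
    intro hU
    refine hinf ((hU.biUnion fun t _ => hi₀ t).subset fun x hx => ?_)
    exact Set.mem_biUnion (Set.mem_image_of_mem _ hx) ⟨hx, rfl⟩
  have hUdef : DefSet L (Set.univ : Set N) ((fun x => x i₀) '' X) :=
    DefPred.ex (Δ := Fin n → N) ((hX.mem .snd).and (.eq ((DefMap.apply i₀).comp .snd) .fst))
  obtain ⟨a, ha⟩ := (hτ.interior_nonempty_iff _ (defSet_iff_definable₁.1 hUdef)).2 hU
  have : (fun _ => a) ∈ interior {u : Fin (n + 1) → N | ∃ b, (u, b) ∈ R} := by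
    refine mem_interior.2 ⟨Set.univ.pi fun _ => interior ((fun x => x i₀) '' X), fun u hu => ?_,
      isOpen_set_pi Set.finite_univ fun _ _ => isOpen_interior, fun _ _ => ha⟩
    exact hdom u fun i => interior_subset (s := (fun x => x i₀) '' X) (hu i trivial)
  rw [noDimensionDrop hN hτ n R hR hfin] at this
  exact this

end Pairing

/-! ### Transfer of pairings between models of `T`. -/

section Transfer

variable {L : FirstOrder.Language.{u, v}} {α : Type w'} {n : ℕ}
variable (φ : L.Formula (α ⊕ Fin n)) (ψ : L.Formula (α ⊕ ((Fin n ⊕ Fin n) ⊕ Fin n)))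

/-- The set of tuples satisfying `φ` with parameters `c`. -/
def solutionSet {S : Type w} [L.Structure S] (c : α → S) : Set (Fin n → S) :=
  {x | φ.Realize (Sum.elim c x)}

/-- The ternary relation on tuples given by `ψ` with parameters `c`. -/
def solutionRel {S : Type w} [L.Structure S] (c : α → S) :
    Set (((Fin n → S) × (Fin n → S)) × (Fin n → S)) :=
  {q | ψ.Realize (Sum.elim c (Sum.elim (Sum.elim q.1.1 q.1.2) q.2))}

/-- The formula saying that the tuples of variables `p` and `q` are equal. -/
noncomputable def tupleEqual {V : Type*} (p q : Fin n → V) : L.Formula V :=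
  Formula.iInf fun i => (Term.var (p i)).equal (Term.var (q i))

/-- The formula saying that the tuple of variables `p` belongs to the solution set of `φ`. -/
def tupleMem {V : Type*} (a : α → V) (p : Fin n → V) : L.Formula V :=
  φ.relabel (Sum.elim a p)

/-- The formula saying that the tuples of variables `p`, `q`, `r` satisfy `ψ`. -/
def tupleRel {V : Type*} (a : α → V) (p q r : Fin n → V) : L.Formula V :=
  ψ.relabel (Sum.elim a (Sum.elim (Sum.elim p q) r))

variable {S : Type w} [L.Structure S] {φ ψ}

theorem realize_tupleEqual {V : Type*} {p q : Fin n → V} {v : V → S} :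
    (tupleEqual (L := L) p q).Realize v ↔ v ∘ p = v ∘ q := by
  simp [tupleEqual, funext_iff]

theorem realize_tupleMem {V : Type*} {a : α → V} {p : Fin n → V} {v : V → S} :
    (tupleMem φ a p).Realize v ↔ v ∘ p ∈ solutionSet φ (v ∘ a) := by
  simp [tupleMem, solutionSet, Sum.comp_elim]

theorem realize_tupleRel {V : Type*} {a : α → V} {p q r : Fin n → V} {v : V → S} :
    (tupleRel ψ a p q r).Realize v ↔ ((v ∘ p, v ∘ q), v ∘ r) ∈ solutionRel ψ (v ∘ a) := by
  simp [tupleRel, solutionRel, Sum.comp_elim]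

variable (φ ψ) in
/-- The formula saying that `φ` and `ψ` define a set and a relation forming an `IsPairing`. -/
noncomputable def pairingFormula : L.Formula α :=
  let var (k : Fin 5) : Fin n → α ⊕ (Fin 5 × Fin n) := fun i => Sum.inr (k, i)
  let mem (k : Fin 5) := tupleMem φ Sum.inl (var k)
  let rel (i j k : Fin 5) := tupleRel ψ Sum.inl (var i) (var j) (var k)
  Formula.iExs (Fin 5 × Fin n) (mem 0 ⊓ (mem 1 ⊓ ∼(tupleEqual (var 0) (var 1)))) ⊓
  (Formula.iAlls (Fin 5 × Fin n) (mem 0 ⟹ (mem 1 ⟹ Formula.iExs (Fin n)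
    (tupleMem φ (Sum.inl ∘ Sum.inl) Sum.inr ⊓
      tupleRel ψ (Sum.inl ∘ Sum.inl) (Sum.inl ∘ var 0) (Sum.inl ∘ var 1) Sum.inr))) ⊓
  (Formula.iAlls (Fin 5 × Fin n) (mem 0 ⟹ (mem 1 ⟹ (mem 2 ⟹ (mem 3 ⟹ (mem 4 ⟹
    (rel 0 1 4 ⟹ (rel 2 3 4 ⟹ (tupleEqual (var 0) (var 2) ⊓ tupleEqual (var 1) (var 3))))))))) ⊓
  Formula.iAlls (Fin 5 × Fin n) (mem 0 ⟹ (mem 1 ⟹ (mem 2 ⟹ (mem 3 ⟹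
    (rel 0 1 2 ⟹ (rel 0 1 3 ⟹ tupleEqual (var 2) (var 3)))))))))

theorem realize_pairingFormula {c : α → S} :
    (pairingFormula φ ψ).Realize c ↔ IsPairing (solutionSet φ c) (solutionRel ψ c) := by
  have hc (u : Fin 5 × Fin n → S) (k : Fin 5) :
      (Sum.elim c u ∘ fun i => Sum.inr (k, i)) = fun i => u (k, i) := rfl
  have hcc (u : Fin 5 × Fin n → S) (x : Fin n → S) (k : Fin 5) :
      (Sum.elim (Sum.elim c u) x ∘ Sum.inl ∘ fun i => Sum.inr (k, i)) = fun i => u (k, i) := rfl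
  have hca (u : Fin 5 × Fin n → S) (x : Fin n → S) :
      (Sum.elim (Sum.elim c u) x ∘ Sum.inl ∘ Sum.inl) = c := rfl
  simp only [pairingFormula, Formula.realize_inf, Formula.realize_iExs, Formula.realize_iAlls,
    Formula.realize_imp, Formula.realize_not, realize_tupleMem, realize_tupleRel,
    realize_tupleEqual, hc, hcc, hca, Sum.elim_comp_inl, Sum.elim_comp_inr]
  constructor
  · rintro ⟨⟨u, h0, h1, hne⟩, htot, hinj, hfun⟩
    refine ⟨⟨_, h0, _, h1, hne⟩, fun x hx y hy => ?_, fun x hx y hy x' hx' y' hy' z hz => ?_,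
      fun x hx y hy z hz z' hz' => ?_⟩
    -- The last three entries are padding for the unused variable blocks.
    · exact htot (fun p => ![x, y, x, x, x] p.1 p.2) hx hy
    · exact hinj (fun p => ![x, y, x', y', z] p.1 p.2) hx hy hx' hy' hz
    · exact hfun (fun p => ![x, y, z, z', x] p.1 p.2) hx hy hz hz'
  · rintro ⟨⟨x, hx, y, hy, hne⟩, htot, hinj, hfun⟩
    exact ⟨⟨fun p => ![x, y, x, x, x] p.1 p.2, hx, hy, hne⟩, fun u hx hy => htot _ hx _ hy,
      fun u h0 h1 h2 h3 h4 => hinj _ h0 _ h1 _ h2 _ h3 _ h4,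
      fun u h0 h1 h2 h3 => hfun _ h0 _ h1 _ h2 _ h3⟩

/-- Quantifying out the finitely many parameters turns the pairing property into a sentence, which
`T` decides. -/
theorem exists_isPairing_of_isComplete {T : L.Theory} (hT : T.IsComplete) [Finite α]
    {M : Type w'} [L.Structure M] [Nonempty M] [M ⊨ T] [Nonempty S] [S ⊨ T] {c : α → M}
    (h : IsPairing (solutionSet φ c) (solutionRel ψ c)) :
    ∃ c' : α → S, IsPairing (solutionSet φ c') (solutionRel ψ c') := by
  let θ : L.Sentence := Formula.iExs α ((pairingFormula φ ψ).relabel (Sum.inr : α → Empty ⊕ α))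
  have hθ {P : Type _} [L.Structure P] : P ⊨ θ ↔ ∃ c : α → P, (pairingFormula φ ψ).Realize c := by
    simp [θ, Sentence.Realize, Function.comp_def]
  have hθ' : S ⊨ θ := by
    rw [hT.realize_sentence_iff, ← hT.realize_sentence_iff θ M]
    simp only [θ, Sentence.Realize, Formula.realize_iExs, Formula.realize_relabel]
    exact ⟨c, by simpa [realize_pairingFormula] using h⟩
  obtain ⟨c', hc'⟩ := hθ.1 hθ'
  exact ⟨c', realize_pairingFormula.1 hc'⟩

theorem defSet_solutionSet {c : α → S} :
    DefSet L (Set.univ : Set S) (solutionSet φ c) := by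
  refine Set.definable_iff_exists_formula_sum.2
    ⟨φ.relabel (Sum.map (fun a => ⟨c a, trivial⟩) id), ?_⟩
  ext x
  simp only [Set.mem_ofPred_eq, Formula.realize_relabel, Sum.elim_comp_map]
  rfl

theorem defSet_solutionRel {c : α → S} :
    DefSet L (Set.univ : Set S) (solutionRel ψ c) := by
  refine Set.definable_iff_exists_formula_sum.2
    ⟨ψ.relabel (Sum.map (fun a => ⟨c a, trivial⟩) id), ?_⟩
  ext x
  simp only [Set.mem_ofPred_eq, Formula.realize_relabel, Sum.elim_comp_map]
  refine Eq.to_iff (congrArg ψ.Realize (congrArg₂ Sum.elim rfl ?_))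
  ext ((i | i) | i) <;> rfl

theorem not_isPairing_of_isTMinimal {T : L.Theory} (hT : T.IsComplete)
    (hmin : IsTMinimal.{u, v, w} T) {M : Type w'} [L.Structure M] [Nonempty M] [M ⊨ T]
    {K : Set (Fin n → M)} {H : Set (((Fin n → M) × (Fin n → M)) × (Fin n → M))}
    (hK : DefSet L (Set.univ : Set M) K) (hH : DefSet L (Set.univ : Set M) H) :
    ¬ IsPairing K H := by
  classical
  intro h
  obtain ⟨N, _, _, _, ⟨κ, hκ, -, hsat, -⟩, τ, hτ⟩ := hmin
  obtain ⟨A₁, -, hA₁⟩ := Set.definable_iff_finitely_definable.1 hK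
  obtain ⟨A₂, -, hA₂⟩ := Set.definable_iff_finitely_definable.1 hH
  obtain ⟨φ, hφ⟩ := Set.definable_iff_exists_formula_sum.1
    (hA₁.mono (B := ((A₁ ∪ A₂ : Finset M) : Set M)) (by simp))
  obtain ⟨ψ, hψ⟩ := Set.definable_iff_exists_formula_sum.1
    (hA₂.mono (B := ((A₁ ∪ A₂ : Finset M) : Set M)) (by simp))
  have hK' : K = solutionSet φ (fun a => (a : M)) := hφ
  have hH' : H = solutionRel ψ (fun a => (a : M)) := by
    ext ⟨⟨x, y⟩, z⟩
    exact Set.ext_iff.1 hψ (Sum.elim (Sum.elim x y) z)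
  rw [hK', hH'] at h
  obtain ⟨c, hc⟩ := exists_isPairing_of_isComplete (S := N) hT h
  exact not_isPairing_of_isTMinimalTopology (IsSaturated.hasUniformFiniteness hκ.le hsat) hτ
    defSet_solutionSet defSet_solutionRel hc

end Transfer

/-! ### The pairing attached to an imperfect field. -/

section Field

variable {L : FirstOrder.Language.{u, v}} {M : Type w} [L.Structure M] {n : ℕ}
  {K : Set (Fin n → M)} [Field K]

theorem IsDefinableField.defSet_add (hK : IsDefinableField L K) :
    DefSet L (Set.univ : Set M)
      {q : ((Fin n → M) × (Fin n → M)) × (Fin n → M) |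
        ∃ x y : K, q.1.1 = x ∧ q.1.2 = y ∧ q.2 = (x + y : K)} := by
  refine (DefSet.mem (defSet_iff_definable.2 hK.add)
    (f := fun q : ((Fin n → M) × (Fin n → M)) × (Fin n → M) =>
      Sum.elim q.1.1 (Sum.elim q.1.2 q.2)) ?_).congr fun q => ?_
  · refine DefMap.pi ?_
    rintro (i | i | i)
    · exact (DefMap.apply i).comp (.comp .fst .fst)
    · exact (DefMap.apply i).comp (.comp .snd .fst)
    · exact (DefMap.apply i).comp .snd
  · simp [Sum.elim_eq_iff]

theorem IsDefinableField.defSet_mul (hK : IsDefinableField L K) :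
    DefSet L (Set.univ : Set M)
      {q : ((Fin n → M) × (Fin n → M)) × (Fin n → M) |
        ∃ x y : K, q.1.1 = x ∧ q.1.2 = y ∧ q.2 = (x * y : K)} := by
  refine (DefSet.mem (defSet_iff_definable.2 hK.mul)
    (f := fun q : ((Fin n → M) × (Fin n → M)) × (Fin n → M) =>
      Sum.elim q.1.1 (Sum.elim q.1.2 q.2)) ?_).congr fun q => ?_
  · refine DefMap.pi ?_
    rintro (i | i | i)
    · exact (DefMap.apply i).comp (.comp .fst .fst)
    · exact (DefMap.apply i).comp (.comp .snd .fst)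
    · exact (DefMap.apply i).comp .snd
  · simp [Sum.elim_eq_iff]

theorem IsDefinableField.defSet_pow (hK : IsDefinableField L K) (k : ℕ) :
    DefSet L (Set.univ : Set M)
      {q : (Fin n → M) × (Fin n → M) | ∃ x : K, q.1 = x ∧ q.2 = (x ^ k : K)} := by
  induction k with
  | zero =>
    refine (DefPred.and (DefSet.mem (L := L) (A := Set.univ) (S := K) hK.carrier .fst)
      (DefPred.eq .snd (.const ((1 : K) : Fin n → M)))).congr fun q => ?_
    constructor
    · rintro ⟨x, h1, h2⟩
      exact ⟨h1 ▸ x.2, by simpa using h2⟩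
    · rintro ⟨h1, h2⟩
      exact ⟨⟨q.1, h1⟩, rfl, by simpa using h2⟩
  | succ k ih =>
    let E := Fin n → M
    let graphPow : Set (E × E) := {q | ∃ x : K, q.1 = x ∧ q.2 = (x ^ k : K)}
    let graphMul : Set ((E × E) × E) :=
      {q | ∃ x y : K, q.1.1 = x ∧ q.1.2 = y ∧ q.2 = (x * y : K)}
    have hpow : DefSet L (Set.univ : Set M) graphPow := ih
    have hmul : DefSet L (Set.univ : Set M) graphMul := hK.defSet_mul
    have : DefPred L (Set.univ : Set M) fun q : E × E => ∃ z : E,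
        (q.1, z) ∈ graphPow ∧ ((z, q.1), q.2) ∈ graphMul :=
      DefPred.ex ((hpow.mem (by fun_prop)).and (hmul.mem (by fun_prop)))
    refine this.congr fun q => ?_
    constructor
    · rintro ⟨x, h1, h2⟩
      exact ⟨(x ^ k : K), ⟨x, h1, rfl⟩, x ^ k, x, rfl, h1, by rw [h2, pow_succ]⟩
    · rintro ⟨z, ⟨x, h1, h2⟩, y, x', h3, h4, h5⟩
      obtain rfl : x = x' := Subtype.ext (h1.symm.trans h4)
      obtain rfl : x ^ k = y := Subtype.ext (h2.symm.trans h3)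
      exact ⟨x, h1, by rw [pow_succ]; exact h5⟩

theorem IsDefinableField.defSet_pow_add_mul_pow (hK : IsDefinableField L K) (p : ℕ) (t : K) :
    DefSet L (Set.univ : Set M)
      {q : ((Fin n → M) × (Fin n → M)) × (Fin n → M) |
        ∃ x y : K, q.1.1 = x ∧ q.1.2 = y ∧ q.2 = (x ^ p + t * y ^ p : K)} := by
  let E := Fin n → M
  let graphPow : Set (E × E) := {q | ∃ x : K, q.1 = x ∧ q.2 = (x ^ p : K)}
  let graphMul : Set ((E × E) × E) := {q | ∃ x y : K, q.1.1 = x ∧ q.1.2 = y ∧ q.2 = (x * y : K)}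
  let graphAdd : Set ((E × E) × E) := {q | ∃ x y : K, q.1.1 = x ∧ q.1.2 = y ∧ q.2 = (x + y : K)}
  have hpow : DefSet L (Set.univ : Set M) graphPow := hK.defSet_pow p
  have hmul : DefSet L (Set.univ : Set M) graphMul := hK.defSet_mul
  have hadd : DefSet L (Set.univ : Set M) graphAdd := hK.defSet_add
  have ht (Γ : Type w) [Coords M Γ] : DefMap L (Set.univ : Set M) fun _ : Γ => (t : E) := .const _
  have : DefPred L (Set.univ : Set M) fun q : (E × E) × E => ∃ a b c : E, (q.1.1, a) ∈ graphPow ∧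
      (q.1.2, b) ∈ graphPow ∧ (((t : E), b), c) ∈ graphMul ∧ ((a, c), q.2) ∈ graphAdd := by
    refine DefPred.ex (DefPred.ex (DefPred.ex ((hpow.mem ?_).and ((hpow.mem ?_).and
      ((hmul.mem ?_).and (hadd.mem ?_))))))
    all_goals fun_prop
  refine this.congr fun q => ?_
  constructor
  · rintro ⟨x, y, h1, h2, h3⟩
    exact ⟨(x ^ p : K), (y ^ p : K), (t * y ^ p : K), ⟨x, h1, rfl⟩, ⟨y, h2, rfl⟩,
      ⟨t, y ^ p, rfl, rfl, rfl⟩, ⟨x ^ p, t * y ^ p, rfl, rfl, h3⟩⟩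
  · rintro ⟨_, _, _, ⟨x, h1, rfl⟩, ⟨y, h2, rfl⟩, ⟨t', y', ht, hy', rfl⟩, ⟨x', s, hx', hs, h3⟩⟩
    obtain rfl := Subtype.ext ht
    obtain rfl := Subtype.ext hy'
    obtain rfl := Subtype.ext hx'
    obtain rfl := Subtype.ext hs
    exact ⟨x, y, h1, h2, h3⟩

/-- Frobenius is additive, so a collision reads `(x - x') ^ p = t * (y' - y) ^ p`. Either `y = y'`
and then `x = x'`, or `t` is the `p`-th power of a quotient. -/
theorem isPairing_pow_add_mul_pow {p : ℕ} [ExpChar K p] {t : K} (ht : ∀ x : K, x ^ p ≠ t) :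
    IsPairing K {q : ((Fin n → M) × (Fin n → M)) × (Fin n → M) |
      ∃ x y : K, q.1.1 = x ∧ q.1.2 = y ∧ q.2 = (x ^ p + t * y ^ p : K)} := by
  refine ⟨⟨_, (0 : K).2, _, (1 : K).2, fun h => zero_ne_one (Subtype.ext h)⟩,
    fun x hx y hy => ⟨_, (⟨x, hx⟩ ^ p + t * ⟨y, hy⟩ ^ p : K).2, ⟨x, hx⟩, ⟨y, hy⟩, rfl, rfl, rfl⟩,
    ?_, ?_⟩
  · rintro _ - _ - _ - _ - _ - ⟨x, y, rfl, rfl, h⟩ ⟨x', y', rfl, rfl, h'⟩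
    have heq : x ^ p + t * y ^ p = x' ^ p + t * y' ^ p := Subtype.ext (h.symm.trans h')
    have hsub : (x - x') ^ p = t * (y' - y) ^ p := by
      rw [sub_pow_expChar, sub_pow_expChar]
      linear_combination heq
    obtain hy | hy := eq_or_ne (y' - y) 0
    · have hp : p ≠ 0 := (expChar_pos K p).ne'
      rw [hy, zero_pow hp, mul_zero] at hsub
      exact ⟨congrArg _ (sub_eq_zero.1 (pow_eq_zero_iff hp |>.1 hsub)),
        congrArg _ (sub_eq_zero.1 hy).symm⟩
    · refine absurd ?_ (ht ((x - x') / (y' - y)))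
      rw [div_pow, hsub, mul_div_cancel_right₀ _ (pow_ne_zero _ hy)]
  · rintro _ - _ - _ - _ - ⟨x, y, rfl, rfl, h⟩ ⟨x', y', hx, hy, h'⟩
    obtain rfl := Subtype.ext hx
    obtain rfl := Subtype.ext hy
    exact h.trans h'.symm

end Field

end TMin

theorem corollary2p37 {L : FirstOrder.Language.{u, v}} (T : L.Theory) (hT : T.IsComplete)
    (hmin : TMin.IsTMinimal.{u, v, w} T)
    (M : Type w') [L.Structure M] [Nonempty M] [M ⊨ T]
    {n : ℕ} (K : Set (Fin n → M)) [Field K] (hK : TMin.IsDefinableField L K) :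
    PerfectField K := by
  -- In characteristic zero `p = 1`, so both characteristics are treated at once.
  obtain ⟨p, _⟩ := ExpChar.exists K
  by_contra hperf
  have hsurj : ¬ Function.Surjective (frobenius K p) := fun h =>
    hperf (@PerfectRing.toPerfectField K p _ _ (PerfectRing.ofSurjective K p h))
  simp only [Function.Surjective, not_forall, not_exists] at hsurj
  obtain ⟨t, ht⟩ := hsurj
  exact TMin.not_isPairing_of_isTMinimal hT hmin hK.carrier (hK.defSet_pow_add_mul_pow p t)
    (TMin.isPairing_pow_add_mul_pow ht)
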